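/- Let $H:\mathbb R^{2n}\to\mathbb R$ be a smooth ($C^\infty$) function, write points of $\mathbb R^{2n}$ as $y=(p,q)$ with $p,q\in\mathbb R^n$, let $J=\begin{pmatrix}0&I\\-I&0\end{pmatrix}$, and consider the Hamiltonian system $\dot y=J^{-1}\nabla H(y)$. For $h>0$ let $\phi_h(y_0)$ denote the value at time $h$ of the solution starting at $y_0$, whenever that solution exists on $[0,h]$. For every compact set $K\subset\mathbb R^{2n}$ there is $h_0>0$ such that for every $h\in(0,h_0)$ the point $y_1=(p_1,q_1):=\phi_h(y_0)$ is well defined for all $y_0=(p_0,q_0)\in K$, and: (a) (symplectic Euler) there is a smooth function $\hat H_{\mathrm{se}}:\mathbb R^{2n}\to\mathbb R$ such that $$J^{-1}\nabla\hat H_{\mathrm{se}}(p_1,q_0)=\frac{y_1-y_0}{h}\qquad\text{for all } y_0\in K;$$ (b) (implicit midpoint) there is a smooth function $\hat H_{\mathrm{mp}}:\mathbb R^{2n}\to\mathbb R$ such that $$J^{-1}\nabla\hat H_{\mathrm{mp}}\Big(\frac{y_0+y_1}{2}\Big)=\frac{y_1-y_0}{h}\qquad\text{for all } y_0\in K.$$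 If moreover $\nabla H$ is globally Lipschitz on $\mathbb R^{2n}$, then the same holds with $K$ replaced by all of $\mathbb R^{2n}$: there is $h_0>0$ such that for every $h\in(0,h_0)$ the map $\phi_h$ is defined on $\mathbb R^{2n}$ and there are smooth $\hat H_{\mathrm{se}},\hat H_{\mathrm{mp}}:\mathbb R^{2n}\to\mathbb R$ satisfying the identities in (a) and (b) for all $y_0\in\mathbb R^{2n}$. -/

import Mathlib

open scoped ContDiff

/-- The phase space `ℝ²ⁿ` with its Euclidean norm. A state is `y = (p, q)`: the left summand of
the index type carries the momentum `p`, the right summand carries the position `q`. -/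
abbrev PhaseSpace (n : ℕ) : Type := EuclideanSpace ℝ (Fin n ⊕ Fin n)

/-- The canonical symplectic matrix `J = (0, I; -I, 0)`. -/
def sympJ (n : ℕ) : Matrix (Fin n ⊕ Fin n) (Fin n ⊕ Fin n) ℝ :=
  Matrix.fromBlocks 0 1 (-1) 0

/-- The inverse of `J`, written out: `J⁻¹ = (0, -I; I, 0)`. -/
theorem sympJ_inv (n : ℕ) : (sympJ n)⁻¹ = Matrix.fromBlocks 0 (-1) 1 0 := by
  apply Matrix.inv_eq_right_inv
  simp [sympJ, Matrix.fromBlocks_multiply]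

/-- The Hamiltonian vector field `y ↦ J⁻¹ ∇H(y)`. -/
noncomputable def hamiltonianField {n : ℕ} (H : PhaseSpace n → ℝ) (y : PhaseSpace n) :
    PhaseSpace n :=
  WithLp.toLp 2 ((sympJ n)⁻¹.mulVec (gradient H y).ofLp)

/-- `y₁ = φ_h(y₀)` (including the claim that `φ_h(y₀)` is defined), where `φ` is the flow of
`ẏ = J⁻¹ ∇H(y)`: there is a solution on the whole of `[0, h]` that starts at `y₀` and ends
at `y₁`. -/
def IsFlowImage {n : ℕ} (H : PhaseSpace n → ℝ) (h : ℝ) (y₀ y₁ : PhaseSpace n) : Prop :=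
  ∃ γ : ℝ → PhaseSpace n, γ 0 = y₀ ∧ γ h = y₁ ∧
    ∀ t ∈ Set.Icc 0 h, HasDerivWithinAt γ (hamiltonianField H (γ t)) (Set.Icc 0 h) t

/-- The state `(p₁, q₀)` with the momentum of `y₁` and the position of `y₀`. -/
noncomputable def mixedState {n : ℕ} (y₀ y₁ : PhaseSpace n) : PhaseSpace n :=
  WithLp.toLp 2 (Sum.elim (fun i => y₁ (Sum.inl i)) (fun i => y₀ (Sum.inr i)))

/-- `G` is a smooth modified Hamiltonian on `ℝ²ⁿ` for the symplectic Euler method with step `h`: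
`J⁻¹ ∇G(p₁, q₀) = (y₁ - y₀) / h` for all `y₀ ∈ Ω` where `y₁ = φ_h(y₀)` is defined. -/
def IsModifiedSymplecticEuler {n : ℕ} (H : PhaseSpace n → ℝ) (h : ℝ) (Ω : Set (PhaseSpace n))
    (G : PhaseSpace n → ℝ) : Prop :=
  ContDiff ℝ ∞ G ∧ ∀ y₀ ∈ Ω, ∀ y₁, IsFlowImage H h y₀ y₁ →
    hamiltonianField G (mixedState y₀ y₁) = h⁻¹ • (y₁ - y₀)

/-- `G` is a smooth modified Hamiltonian on `ℝ²ⁿ` for the implicit midpoint rule with step `h`: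
`J⁻¹ ∇G((y₀ + y₁) / 2) = (y₁ - y₀) / h` for all `y₀ ∈ Ω` where `y₁ = φ_h(y₀)` is defined. -/
def IsModifiedMidpoint {n : ℕ} (H : PhaseSpace n → ℝ) (h : ℝ) (Ω : Set (PhaseSpace n))
    (G : PhaseSpace n → ℝ) : Prop :=
  ContDiff ℝ ∞ G ∧ ∀ y₀ ∈ Ω, ∀ y₁, IsFlowImage H h y₀ y₁ →
    hamiltonianField G ((2 : ℝ)⁻¹ • (y₀ + y₁)) = h⁻¹ • (y₁ - y₀)

-- Write `S = J⁻¹` and `φ` for the time-`h` map. Both methods read `y₁ = y₀ + h S∇G(y₀ + P(y₁ -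
-- y₀))`, with `P` the momentum projection or half the identity. For small `h` and a Lipschitz
-- field, `φ - id` is a contraction, so `A = id + P(φ - id)` is a global diffeomorphism and `∇G`
-- must be `F = -h⁻¹ S(φ - id) ∘ A⁻¹`. Symplecticity of `φ` and the identity `⟨Sx, Py⟩ + ⟨SPx, y⟩ =
-- ⟨Sx, y⟩` make `DF` symmetric, so the Poincaré lemma supplies `G`
-- (`exists_flow_and_modified_hamiltonian`). Smoothness of `φ` comes from inverting the integral
-- equation on a space of curves (`exists_smooth_flow`). For compact `K`, the Hamiltonian is cut off
-- far from `K`; short trajectories from `K` do not see the change.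

universe u

/-- A contraction perturbing the identity leaves it bijective; the derivative is within `c < 1` of
`1`, hence invertible by a Neumann series, so the inverse is smooth. -/
theorem exists_homeomorph_of_lipschitzWith_sub_id {E : Type*} [NormedAddCommGroup E]
    [NormedSpace ℝ E] [CompleteSpace E] {f : E → E} {c : NNReal} (hf : ContDiff ℝ ∞ f)
    (hc : c < 1) (hL : LipschitzWith c (fun x => f x - x)) :
    ∃ e : E ≃ₜ E, (∀ x, e x = f x) ∧ ContDiff ℝ ∞ e.symm := by
  have happ : ApproximatesLinearOn f
      ((ContinuousLinearEquiv.refl ℝ E : E ≃L[ℝ] E) : E →L[ℝ] E) Set.univ c := by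
    refine LipschitzOnWith.approximatesLinearOn ?_
    rw [lipschitzOnWith_univ]
    exact hL
  have hcN : Subsingleton E ∨
      c < ‖((ContinuousLinearEquiv.refl ℝ E).symm : E →L[ℝ] E)‖₊⁻¹ := by
    rcases subsingleton_or_nontrivial E with h | h
    · exact Or.inl h
    · right
      have : ‖((ContinuousLinearEquiv.refl ℝ E).symm : E →L[ℝ] E)‖₊ = 1 :=
        ContinuousLinearMap.nnnorm_id
      simpa [this] using hc
  have hdiff : Differentiable ℝ f := hf.differentiable (by simp)
  have hunit : ∀ x, IsUnit (fderiv ℝ f x) := by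
    intro x
    have h1 : HasFDerivAt (fun x => f x - x) (fderiv ℝ f x - ContinuousLinearMap.id ℝ E) x :=
      (hdiff x).hasFDerivAt.sub (hasFDerivAt_id x)
    have h2 : ‖fderiv ℝ f x - 1‖ ≤ c := by
      have := norm_fderiv_le_of_lipschitz ℝ (x₀ := x) hL
      rwa [h1.fderiv] at this
    have h3 : ‖1 - fderiv ℝ f x‖ < 1 := by
      rw [norm_sub_rev]; exact h2.trans_lt (by exact_mod_cast hc)
    simpa using isUnit_one_sub_of_norm_lt_one h3
  refine ⟨happ.toHomeomorph f hcN, fun x => rfl, ?_⟩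
  refine Homeomorph.contDiff_symm (f₀' := fun x => ContinuousLinearEquiv.unitsEquiv ℝ E
    (hunit x).unit) _ (fun x => ?_) hf
  exact (hdiff x).hasFDerivAt

/-! ### Smoothness of `γ ↦ X ∘ γ` on continuous curves -/

section Nemytskii

variable {K : Type*} [TopologicalSpace K] [CompactSpace K]

/-- Pointwise evaluation of a continuous family of continuous linear maps on a continuous family
of vectors, as a continuous bilinear map. -/
noncomputable def ContinuousMap.applyBilin (K : Type*) [TopologicalSpace K] [CompactSpace K]
    (E F : Type*) [NormedAddCommGroup E] [NormedSpace ℝ E] [NormedAddCommGroup F]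
    [NormedSpace ℝ F] : C(K, E →L[ℝ] F) →L[ℝ] C(K, E) →L[ℝ] C(K, F) :=
  LinearMap.mkContinuous₂
    (LinearMap.mk₂ ℝ (fun (A : C(K, E →L[ℝ] F)) (v : C(K, E)) =>
      (⟨fun t => A t (v t), by fun_prop⟩ : C(K, F)))
      (fun _ _ _ => by ext; simp) (fun _ _ _ => by ext; simp)
      (fun _ _ _ => by ext; simp) (fun _ _ _ => by ext; simp)) 1
    (fun A v => by
      rw [one_mul, ContinuousMap.norm_le _ (by positivity)]
      intro t
      exact ((A t).le_opNorm _).trans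
        (mul_le_mul (A.norm_coe_le_norm t) (v.norm_coe_le_norm t) (by positivity) (by positivity)))

theorem ContinuousMap.applyBilin_apply {E F : Type*} [NormedAddCommGroup E] [NormedSpace ℝ E]
    [NormedAddCommGroup F] [NormedSpace ℝ F] (A : C(K, E →L[ℝ] F)) (v : C(K, E)) (t : K) :
    ContinuousMap.applyBilin K E F A v t = A t (v t) := rfl

/-- The range of `γ` is compact, so `X'` is uniformly continuous near it and the mean value estimate
is uniform in `t`. -/
theorem ContinuousMap.hasFDerivAt_comp_left {E F : Type*} [NormedAddCommGroup E]
    [NormedSpace ℝ E] [NormedAddCommGroup F] [NormedSpace ℝ F] (X : C(E, F)) (X' : C(E, E →L[ℝ] F))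
    (hX : ∀ x, HasFDerivAt X (X' x) x) (γ : C(K, E)) :
    HasFDerivAt (fun γ : C(K, E) => X.comp γ)
      (ContinuousMap.applyBilin K E F (X'.comp γ)) γ := by
  rw [hasFDerivAt_iff_isLittleO_nhds_zero, Asymptotics.isLittleO_iff]
  intro ε hε
  have hcpt : IsCompact (Set.range γ) := isCompact_range γ.continuous
  have hu := hcpt.uniformContinuousAt_of_continuousAt X' (fun a _ => X'.continuous.continuousAt)
    (Metric.dist_mem_uniformity hε)
  obtain ⟨δ, hδ, hδ'⟩ := Metric.mem_uniformity_dist.1 hu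
  filter_upwards [Metric.ball_mem_nhds (0 : C(K, E)) hδ] with v hv
  rw [ContinuousMap.norm_le _ (by positivity)]
  intro t
  have hvt : ‖v t‖ < δ := (v.norm_coe_le_norm t).trans_lt (by simpa using hv)
  have key := (convex_ball (γ t) δ).norm_image_sub_le_of_norm_hasFDerivWithin_le'
    (f := X) (f' := X') (φ := X' (γ t)) (C := ε) (x := γ t) (y := γ t + v t)
    (fun x _ => (hX x).hasFDerivWithinAt)
    (fun x hx => by
      have := hδ' (a := γ t) (b := x) (by rw [dist_comm]; exact hx) (Set.mem_range_self t)
      rw [← dist_eq_norm, dist_comm]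
      exact this.le) (Metric.mem_ball_self hδ) (by simpa using hvt)
  simp only [ContinuousMap.coe_sub, Pi.sub_apply, ContinuousMap.comp_apply,
    ContinuousMap.add_apply, ContinuousMap.applyBilin_apply]
  simp only [add_sub_cancel_left] at key
  exact key.trans (mul_le_mul_of_nonneg_left (v.norm_coe_le_norm t) hε.le)

/-- The derivative is again a composition operator, that of `X'`, followed by a bounded linear map.
The induction changes the target to `E →L[ℝ] F`, hence the quantified `F` and the common universe.
-/
theorem ContinuousMap.contDiff_natCast_comp_left {E : Type u} [NormedAddCommGroup E]
    [NormedSpace ℝ E] (n : ℕ) : ∀ {F : Type u} [NormedAddCommGroup F] [NormedSpace ℝ F]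
    (X : C(E, F)), ContDiff ℝ n X → ContDiff ℝ n (fun γ : C(K, E) => X.comp γ) := by
  induction n with
  | zero =>
    intro F _ _ X _
    exact contDiff_zero.2 (ContinuousMap.continuous_postcomp X)
  | succ n ih =>
    intro F _ _ X hX
    have hX' : ContDiff ℝ (n + 1 : ℕ∞ω) X := by exact_mod_cast hX
    have hc : ContDiff ℝ n (fderiv ℝ X) := (contDiff_succ_iff_fderiv.1 hX').2.2
    let X' : C(E, E →L[ℝ] F) := ⟨fderiv ℝ X, hc.continuous⟩
    have hd : ∀ x, HasFDerivAt X (X' x) x := fun x =>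
      ((contDiff_succ_iff_fderiv.1 hX').1 x).hasFDerivAt
    push_cast
    rw [contDiff_succ_iff_hasFDerivAt]
    have hb : ContDiff ℝ n (fun A : C(K, E →L[ℝ] F) => ContinuousMap.applyBilin K E F A) := by
      fun_prop
    exact ⟨fun γ => ContinuousMap.applyBilin K E F (X'.comp γ),
      hb.comp (ih X' hc),
      fun γ => ContinuousMap.hasFDerivAt_comp_left X X' hd γ⟩

theorem ContinuousMap.contDiff_comp_left {E F : Type u} [NormedAddCommGroup E]
    [NormedSpace ℝ E] [NormedAddCommGroup F] [NormedSpace ℝ F] (X : C(E, F))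
    (hX : ContDiff ℝ ∞ X) : ContDiff ℝ ∞ (fun γ : C(K, E) => X.comp γ) :=
  contDiff_infty.2 fun n => ContinuousMap.contDiff_natCast_comp_left n X (contDiff_infty.1 hX n)

end Nemytskii

/-! ### The integral form of the differential equation -/

section Volterra

variable {E : Type*} [NormedAddCommGroup E] [NormedSpace ℝ E]

/-- The Volterra operator `f ↦ ∫₀ᵗ f` on continuous functions on `[0, h]`. -/
noncomputable def volterra (E : Type*) [NormedAddCommGroup E] [NormedSpace ℝ E] {h : ℝ}
    (hh : 0 ≤ h) : C(Set.Icc (0 : ℝ) h, E) →L[ℝ] C(Set.Icc (0 : ℝ) h, E) :=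
  LinearMap.mkContinuous
    { toFun := fun f => ⟨fun t => ∫ s in (0 : ℝ)..t, Set.IccExtend hh f s,
        (intervalIntegral.continuous_primitive
          (fun a b => (f.continuous.Icc_extend').intervalIntegrable a b) 0).comp
          continuous_subtype_val⟩
      map_add' := fun f g => by
        ext t
        exact intervalIntegral.integral_add
          ((f.continuous.Icc_extend').intervalIntegrable _ _)
          ((g.continuous.Icc_extend').intervalIntegrable _ _)
      map_smul' := fun c f => by
        ext t
        exact intervalIntegral.integral_smul c (Set.IccExtend hh f) } h
    (fun f => by
      rw [ContinuousMap.norm_le _ (by positivity)]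
      intro t
      have := intervalIntegral.norm_integral_le_of_norm_le_const (a := (0 : ℝ)) (b := t)
        (f := Set.IccExtend hh f) (C := ‖f‖) (fun s _ => f.norm_coe_le_norm _)
      refine this.trans ?_
      rw [sub_zero, abs_of_nonneg t.2.1, mul_comm]
      exact mul_le_mul_of_nonneg_right t.2.2 (norm_nonneg _))

theorem volterra_apply {h : ℝ} (hh : 0 ≤ h) (f : C(Set.Icc (0 : ℝ) h, E)) (t : Set.Icc (0 : ℝ) h) :
    volterra E hh f t = ∫ s in (0 : ℝ)..t, Set.IccExtend hh f s := rfl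

theorem norm_volterra_le {h : ℝ} (hh : 0 ≤ h) (f : C(Set.Icc (0 : ℝ) h, E)) :
    ‖volterra E hh f‖ ≤ h * ‖f‖ :=
  (volterra E hh).le_of_opNorm_le (LinearMap.mkContinuous_norm_le _ hh _) f

theorem hasDerivWithinAt_of_eq_const_add_volterra [CompleteSpace E] {h : ℝ} (hh : 0 ≤ h)
    {f g : C(Set.Icc (0 : ℝ) h, E)} {a : E}
    (hfg : f = ContinuousMap.const _ a + volterra E hh g) {t : ℝ} (ht : t ∈ Set.Icc 0 h) :
    HasDerivWithinAt (Set.IccExtend hh f) (g ⟨t, ht⟩) (Set.Icc 0 h) t := by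
  have hc : Continuous (Set.IccExtend hh g) := g.continuous.Icc_extend'
  have h1 : HasDerivAt (fun t => a + ∫ s in (0 : ℝ)..t, Set.IccExtend hh g s)
      (Set.IccExtend hh g t) t :=
    (intervalIntegral.integral_hasDerivAt_right (hc.intervalIntegrable _ _)
      (hc.stronglyMeasurableAtFilter _ _) hc.continuousAt).const_add a
  rw [Set.IccExtend_of_mem hh g ht] at h1
  refine h1.hasDerivWithinAt.congr_of_mem (fun s hs => ?_) ht
  rw [Set.IccExtend_of_mem hh f hs, hfg]
  rfl

theorem IccExtend_zero_of_eq_const_add_volterra {h : ℝ} (hh : 0 ≤ h)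
    {f g : C(Set.Icc (0 : ℝ) h, E)} {a : E}
    (hfg : f = ContinuousMap.const _ a + volterra E hh g) : Set.IccExtend hh f 0 = a := by
  rw [Set.IccExtend_of_mem hh f ⟨le_rfl, hh⟩, hfg]
  simp [volterra_apply]

end Volterra

/-- A smooth globally Lipschitz vector field has, for short times `h`, a smooth time-`h` map that
is close to the identity, and whose derivative is given by the variational equation. -/
theorem exists_smooth_flow {E : Type u} [NormedAddCommGroup E] [NormedSpace ℝ E] [CompleteSpace E]
    {X : E → E} (hX : ContDiff ℝ ∞ X) {L : NNReal} (hL : LipschitzWith L X) {h : ℝ} (hh : 0 ≤ h)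
    (hhL : h * L ≤ 1 / 4) :
    ∃ Φ : E → ℝ → E,
      (∀ y, Φ y 0 = y) ∧
      (∀ y, ∀ t ∈ Set.Icc 0 h, HasDerivWithinAt (Φ y) (X (Φ y t)) (Set.Icc 0 h) t) ∧
      ContDiff ℝ ∞ (fun y => Φ y h) ∧
      LipschitzWith (1 / 3) (fun y => Φ y h - y) ∧
      ∀ y v, ∃ u : ℝ → E, u 0 = v ∧ u h = fderiv ℝ (fun y => Φ y h) y v ∧
        ∀ t ∈ Set.Icc 0 h,
          HasDerivWithinAt u (fderiv ℝ X (Φ y t) (u t)) (Set.Icc 0 h) t := by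
  let I := Set.Icc (0 : ℝ) h
  let Xc : C(E, E) := ⟨X, hX.continuous⟩
  have hX' : ContDiff ℝ ∞ (fderiv ℝ X) := hX.fderiv_right (by simp)
  let X' : C(E, E →L[ℝ] E) := ⟨fderiv ℝ X, hX'.continuous⟩
  have hXd : ∀ x, HasFDerivAt Xc (X' x) x := fun x =>
    (hX.differentiable (by simp) x).hasFDerivAt
  let V := volterra E hh
  -- Solutions from `y` are the solutions of `f γ = const y`; inverting `f` gives existence and
  -- smooth dependence on `y` together.
  let f : C(I, E) → C(I, E) := fun γ => γ - V (Xc.comp γ)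
  have hfs : ContDiff ℝ ∞ f :=
    contDiff_id.sub (V.contDiff.comp (ContinuousMap.contDiff_comp_left Xc hX))
  have hVX : ∀ γ δ : C(I, E), ‖V (Xc.comp γ) - V (Xc.comp δ)‖ ≤ 1 / 4 * ‖γ - δ‖ := by
    intro γ δ
    rw [← map_sub]
    refine (norm_volterra_le hh _).trans ?_
    have h1 : ‖Xc.comp γ - Xc.comp δ‖ ≤ L * ‖γ - δ‖ := by
      rw [ContinuousMap.norm_le _ (by positivity)]
      intro t
      have := hL.norm_sub_le (γ t) (δ t)
      exact this.trans (mul_le_mul_of_nonneg_left ((γ - δ).norm_coe_le_norm t) L.2)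
    calc h * ‖Xc.comp γ - Xc.comp δ‖ ≤ h * (L * ‖γ - δ‖) := mul_le_mul_of_nonneg_left h1 hh
      _ = h * L * ‖γ - δ‖ := by ring
      _ ≤ _ := mul_le_mul_of_nonneg_right hhL (norm_nonneg _)
  obtain ⟨e, he, hes⟩ := exists_homeomorph_of_lipschitzWith_sub_id (c := 1 / 4) hfs
    (by rw [← NNReal.coe_lt_coe]; norm_num) (LipschitzWith.of_dist_le_mul fun γ δ => by
      rw [dist_eq_norm, dist_eq_norm]
      have : f γ - γ - (f δ - δ) = -(V (Xc.comp γ) - V (Xc.comp δ)) := by simp only [f]; abel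
      rw [this, norm_neg]
      simpa using hVX γ δ)
  let cst : E →L[ℝ] C(I, E) := ContinuousLinearMap.const ℝ I
  let Γ : E → C(I, E) := fun y => e.symm (cst y)
  have hΓs : ContDiff ℝ ∞ Γ := hes.comp cst.contDiff
  have hΓ : ∀ y, Γ y = ContinuousMap.const _ y + V (Xc.comp (Γ y)) := by
    intro y
    have : f (Γ y) = cst y := by rw [← he]; exact e.apply_symm_apply _
    exact sub_eq_iff_eq_add.1 this
  have hmem : h ∈ Set.Icc 0 h := ⟨hh, le_rfl⟩
  have hend : ∀ y, Set.IccExtend hh (Γ y) h = Γ y ⟨h, hmem⟩ := fun y =>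
    Set.IccExtend_of_mem hh _ hmem
  -- Here `4/3 = 1/(1 - 1/4)`; the final constant is `1/4 * 4/3 = 1/3`.
  have hΓL : ∀ y z, ‖Γ y - Γ z‖ ≤ 4 / 3 * ‖y - z‖ := by
    intro y z
    have h1 : Γ y - Γ z = cst (y - z) + (V (Xc.comp (Γ y)) - V (Xc.comp (Γ z))) := by
      conv_lhs => rw [hΓ y, hΓ z]
      rw [map_sub]
      change cst y + _ - (cst z + _) = _
      abel
    have h2 : ‖cst (y - z)‖ ≤ ‖y - z‖ := by
      rw [ContinuousMap.norm_le _ (by positivity)]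
      intro t
      exact le_rfl
    have h3 : ‖Γ y - Γ z‖ ≤ ‖cst (y - z)‖ + ‖V (Xc.comp (Γ y)) - V (Xc.comp (Γ z))‖ := by
      conv_lhs => rw [h1]
      exact norm_add_le _ _
    linarith [hVX (Γ y) (Γ z)]
  have hφ : (fun y => Set.IccExtend hh (Γ y) h) =
      fun y => ContinuousMap.evalCLM ℝ (⟨h, hmem⟩ : I) (Γ y) := funext hend
  refine ⟨fun y => Set.IccExtend hh (Γ y), fun y => IccExtend_zero_of_eq_const_add_volterra hh (hΓ y),
    fun y t ht => ?_, ?_, ?_, fun y v => ?_⟩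
  · beta_reduce
    rw [Set.IccExtend_of_mem hh _ ht]
    exact hasDerivWithinAt_of_eq_const_add_volterra hh (hΓ y) ht
  · rw [hφ]
    exact (ContinuousMap.evalCLM ℝ (⟨h, hmem⟩ : I)).contDiff.comp hΓs
  · refine LipschitzWith.of_dist_le_mul fun y z => ?_
    have h1 : ∀ y, Set.IccExtend hh (Γ y) h - y = V (Xc.comp (Γ y)) ⟨h, hmem⟩ := by
      intro y
      rw [hend, sub_eq_iff_eq_add']
      exact congrArg (fun g : C(I, E) => g ⟨h, hmem⟩) (hΓ y)
    rw [dist_eq_norm, dist_eq_norm, h1, h1]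
    have h2 := (V (Xc.comp (Γ y)) - V (Xc.comp (Γ z))).norm_coe_le_norm ⟨h, hmem⟩
    have h3 := hVX (Γ y) (Γ z)
    have h4 := hΓL y z
    simp only [ContinuousMap.sub_apply] at h2
    push_cast
    linarith
  · have hΓd : HasFDerivAt Γ (fderiv ℝ Γ y) y := (hΓs.differentiable (by simp) y).hasFDerivAt
    -- Differentiating the fixed-point equation in `y` yields the integrated variational equation.
    have hfix : fderiv ℝ Γ y v = ContinuousMap.const _ v +
        V (ContinuousMap.applyBilin I E E (X'.comp (Γ y)) (fderiv ℝ Γ y v)) := by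
      have h1 : HasFDerivAt Γ (cst + V.comp
          ((ContinuousMap.applyBilin I E E (X'.comp (Γ y))).comp (fderiv ℝ Γ y))) y := by
        have := cst.hasFDerivAt.add (V.hasFDerivAt.comp y
          ((ContinuousMap.hasFDerivAt_comp_left Xc X' hXd (Γ y)).comp y hΓd))
        exact this.congr_of_eventuallyEq (Filter.Eventually.of_forall hΓ)
      have h2 := congrArg (fun T : E →L[ℝ] C(I, E) => T v) h1.fderiv
      exact h2
    refine ⟨Set.IccExtend hh (fderiv ℝ Γ y v),
      IccExtend_zero_of_eq_const_add_volterra hh hfix, ?_, fun t ht => ?_⟩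
    · rw [hφ, Set.IccExtend_of_mem hh _ hmem]
      have := (ContinuousMap.evalCLM ℝ (⟨h, hmem⟩ : I)).hasFDerivAt.comp y hΓd
      exact (congrArg (fun T : E →L[ℝ] E => T v) this.fderiv).symm
    · beta_reduce
      rw [Set.IccExtend_of_mem hh _ ht, Set.IccExtend_of_mem hh _ ht]
      exact hasDerivWithinAt_of_eq_const_add_volterra hh hfix ht

/-! ### Gradients and symmetric derivatives -/

section Gradient

variable {E : Type*} [NormedAddCommGroup E] [InnerProductSpace ℝ E] [CompleteSpace E]

/-- The Riesz isomorphism of a real Hilbert space as a linear map. -/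
noncomputable def rieszRepr (E : Type*) [NormedAddCommGroup E] [InnerProductSpace ℝ E]
    [CompleteSpace E] : (E →L[ℝ] ℝ) →L[ℝ] E :=
  LinearMap.mkContinuous
    { toFun := fun l => (InnerProductSpace.toDual ℝ E).symm l
      map_add' := fun _ _ => map_add _ _ _
      map_smul' := fun _ _ => by simp } 1 (fun l => by simp)

theorem inner_rieszRepr (l : E →L[ℝ] ℝ) (x : E) : inner ℝ (rieszRepr E l) x = l x :=
  InnerProductSpace.toDual_symm_apply

theorem ContDiff.gradient {H : E → ℝ} (hH : ContDiff ℝ ∞ H) : ContDiff ℝ ∞ (gradient H) :=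
  (rieszRepr E).contDiff.comp (hH.fderiv_right (by simp))

theorem inner_fderiv_gradient_comm {H : E → ℝ} (hH : ContDiff ℝ ∞ H) (x v w : E) :
    inner ℝ (fderiv ℝ (gradient H) x v) w = inner ℝ v (fderiv ℝ (gradient H) x w) := by
  have hd : ContDiff ℝ ∞ (fderiv ℝ H) := hH.fderiv_right (by simp)
  have h1 : fderiv ℝ (gradient H) x = (rieszRepr E).comp (fderiv ℝ (fderiv ℝ H) x) :=
    ((rieszRepr E).hasFDerivAt.comp x (hd.differentiable (by simp) x).hasFDerivAt).fderiv
  have hs : IsSymmSndFDerivAt ℝ H x := (contDiff_infty.1 hH 2).contDiffAt.isSymmSndFDerivAt (by simp)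
  rw [h1, ContinuousLinearMap.comp_apply, ContinuousLinearMap.comp_apply, inner_rieszRepr,
    real_inner_comm, inner_rieszRepr]
  exact hs.eq v w

/-- A vector field with symmetric derivative is the gradient of a smooth function. -/
theorem exists_gradient_eq {F : E → E} (hF : ContDiff ℝ ∞ F)
    (hsymm : ∀ x v w, inner ℝ (fderiv ℝ F x v) w = inner ℝ (fderiv ℝ F x w) v) :
    ∃ G : E → ℝ, ContDiff ℝ ∞ G ∧ ∀ x, gradient G x = F x := by
  let ι : E →L[ℝ] E →L[ℝ] ℝ := LinearMap.mkContinuous₂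
    (LinearMap.mk₂ ℝ (fun x y : E => inner ℝ x y) (fun _ _ _ => inner_add_left _ _ _)
      (fun _ _ _ => real_inner_smul_left _ _ _) (fun _ _ _ => inner_add_right _ _ _)
      (fun _ _ _ => real_inner_smul_right _ _ _)) 1
    (fun x y => by simpa using abs_real_inner_le_norm x y)
  have hι : ∀ x y, ι x y = inner ℝ x y := fun _ _ => rfl
  have hω : ∀ x, HasFDerivAt (fun x => ι (F x)) (ι.comp (fderiv ℝ F x)) x := fun x =>
    ι.hasFDerivAt.comp x (hF.differentiable (by simp) x).hasFDerivAt
  obtain ⟨G, hG⟩ := convex_univ.exists_forall_hasFDerivAt_of_fderiv_symmetric isOpen_univ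
    (fun x _ => (hω x).differentiableAt.differentiableWithinAt :
      DifferentiableOn ℝ (fun x => ι (F x)) Set.univ)
    (fun a _ x y => by
      rw [(hω a).fderiv]
      exact hsymm a x y)
  have hG' : fderiv ℝ G = fun x => ι (F x) := funext fun x => (hG x trivial).fderiv
  refine ⟨G, ?_, fun x => ?_⟩
  · rw [contDiff_infty_iff_fderiv]
    refine ⟨fun x => (hG x trivial).differentiableAt, ?_⟩
    rw [hG']
    exact ι.contDiff.comp hF
  · refine ext_inner_right ℝ fun y => ?_
    rw [inner_gradient_left, hG']
    rfl

end Gradient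

/-! ### Symplecticity and the modified Hamiltonian -/

section Symplectic

variable {E : Type u} [NormedAddCommGroup E] [InnerProductSpace ℝ E] [CompleteSpace E]
  {S : E →L[ℝ] E} {H : E → ℝ}

/-- With `A` the Hessian along `γ`, the derivative of `⟨Su, w⟩` is `⟨SSAu, w⟩ + ⟨Su, SAw⟩ = -⟨Au, w⟩
+ ⟨u, Aw⟩ = 0`. -/
theorem inner_eq_of_variational_equation (hS : ∀ x, S (S x) = -x)
    (hskew : ∀ x y, inner ℝ (S x) y = -inner ℝ x (S y)) (hH : ContDiff ℝ ∞ H) {h : ℝ} (hh : 0 ≤ h)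
    {γ u w : ℝ → E}
    (hu : ∀ t ∈ Set.Icc 0 h, HasDerivWithinAt u
      (fderiv ℝ (fun y => S (gradient H y)) (γ t) (u t)) (Set.Icc 0 h) t)
    (hw : ∀ t ∈ Set.Icc 0 h, HasDerivWithinAt w
      (fderiv ℝ (fun y => S (gradient H y)) (γ t) (w t)) (Set.Icc 0 h) t) :
    inner ℝ (S (u h)) (w h) = inner ℝ (S (u 0)) (w 0) := by
  have hX : ∀ y v, fderiv ℝ (fun y => S (gradient H y)) y v = S (fderiv ℝ (gradient H) y v) := by
    intro y v
    have := (S.hasFDerivAt.comp y (hH.gradient.differentiable (by simp) y).hasFDerivAt).fderiv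
    exact congrArg (fun T : E →L[ℝ] E => T v) this
  have hd : ∀ t ∈ Set.Icc 0 h,
      HasDerivWithinAt (fun t => inner ℝ (S (u t)) (w t)) 0 (Set.Icc 0 h) t := by
    intro t ht
    have h1 := (S.hasFDerivAt.comp_hasDerivWithinAt t (hu t ht)).inner ℝ (hw t ht)
    refine h1.congr_deriv ?_
    have h2 := inner_fderiv_gradient_comm hH (γ t) (u t) (w t)
    simp only [Function.comp_apply, hX, hS, inner_neg_left]
    rw [hskew, hS, inner_neg_right, h2]
    ring
  exact constant_of_derivWithin_zero (fun t ht => (hd t ht).differentiableWithinAt)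
    (fun t ht => (hd t (Set.Ico_subset_Icc_self ht)).derivWithin
      (uniqueDiffOn_Icc (ht.1.trans_lt ht.2) t (Set.Ico_subset_Icc_self ht))) h ⟨hh, le_rfl⟩

/-- The flow of a Hamiltonian vector field with globally Lipschitz gradient exists for short times,
and its time-`h` map is a step of the one-step method `y₁ = y₀ + h S ∇G (y₀ + P (y₁ - y₀))` for
some smooth `G`. -/
theorem exists_flow_and_modified_hamiltonian (hS : ∀ x, S (S x) = -x)
    (hskew : ∀ x y, inner ℝ (S x) y = -inner ℝ x (S y)) (hH : ContDiff ℝ ∞ H) {L : NNReal}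
    (hL : LipschitzWith L (fun y => S (gradient H y))) {h : ℝ} (hh : 0 ≤ h)
    (hhL : h * L ≤ 1 / 4) :
    ∃ Φ : E → ℝ → E,
      (∀ y, Φ y 0 = y) ∧
      (∀ y, ∀ t ∈ Set.Icc 0 h,
        HasDerivWithinAt (Φ y) (S (gradient H (Φ y t))) (Set.Icc 0 h) t) ∧
      ∀ P : E →L[ℝ] E, ‖P‖ ≤ 1 →
        (∀ x y, inner ℝ (S x) (P y) + inner ℝ (S (P x)) y = inner ℝ (S x) y) →
        ∃ G : E → ℝ, ContDiff ℝ ∞ G ∧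
          ∀ y, S (gradient G (y + P (Φ y h - y))) = h⁻¹ • (Φ y h - y) := by
  obtain ⟨Φ, hΦ0, hΦ, hΦs, hΦL, hΦd⟩ := exists_smooth_flow (X := fun y => S (gradient H y))
    (S.contDiff.comp hH.gradient) hL hh hhL
  refine ⟨Φ, hΦ0, hΦ, fun P hP hSP => ?_⟩
  let φ : E → E := fun y => Φ y h
  have hφd : ∀ y, HasFDerivAt φ (fderiv ℝ φ y) y := fun y =>
    (hΦs.differentiable (by simp) y).hasFDerivAt
  have hsymp : ∀ y v w, inner ℝ (S (fderiv ℝ φ y v)) (fderiv ℝ φ y w) = inner ℝ (S v) w := by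
    intro y v w
    obtain ⟨a, ha0, hah, ha⟩ := hΦd y v
    obtain ⟨b, hb0, hbh, hb⟩ := hΦd y w
    have := inner_eq_of_variational_equation hS hskew hH hh ha hb
    rwa [ha0, hb0, hah, hbh] at this
  let A : E → E := fun y => y + P (φ y - y)
  have hAs : ContDiff ℝ ∞ A := contDiff_id.add (P.contDiff.comp (hΦs.sub contDiff_id))
  obtain ⟨e, he, hes⟩ := exists_homeomorph_of_lipschitzWith_sub_id (c := 1 / 3) hAs
    (by rw [← NNReal.coe_lt_coe]; norm_num) (LipschitzWith.of_dist_le_mul fun y z => by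
      have h1 := hΦL.dist_le_mul y z
      rw [dist_eq_norm] at h1 ⊢
      have h2 : A y - y - (A z - z) = P (Φ y h - y - (Φ z h - z)) := by
        simp only [A, φ, map_sub]; abel
      rw [h2]
      exact (P.le_of_opNorm_le hP _).trans (by rwa [one_mul]))
  let F : E → E := fun z => -(h⁻¹ • S (φ (e.symm z) - e.symm z))
  have hFs : ContDiff ℝ ∞ F :=
    (contDiff_const.smul (S.contDiff.comp ((hΦs.comp hes).sub hes))).neg
  obtain ⟨G, hGs, hG⟩ := exists_gradient_eq hFs (by
    intro z v w
    set y := e.symm z with hy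
    let B := fderiv ℝ e.symm z
    have hB : HasFDerivAt e.symm B z := (hes.differentiable (by simp) z).hasFDerivAt
    have hφB : HasFDerivAt (fun z => φ (e.symm z)) ((fderiv ℝ φ y).comp B) z :=
      (hφd y).comp z hB
    have hF' : fderiv ℝ F z = -(h⁻¹ • S.comp ((fderiv ℝ φ y).comp B - B)) :=
      (((S.hasFDerivAt.comp z (hφB.sub hB)).const_smul h⁻¹).neg).fderiv
    -- This is the derivative of `A ∘ A⁻¹ = id`.
    have hAB : ∀ v, v = B v + P (fderiv ℝ φ y (B v) - B v) := by
      intro v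
      have h1 : HasFDerivAt (fun z => A (e.symm z)) (B + P.comp ((fderiv ℝ φ y).comp B - B)) z :=
        hB.add (P.hasFDerivAt.comp z (hφB.sub hB))
      have h2 : (fun z => A (e.symm z)) = id := by
        funext z
        rw [← he]
        exact e.apply_symm_apply z
      rw [h2] at h1
      exact congrArg (fun T : E →L[ℝ] E => T v) ((hasFDerivAt_id z).unique h1)
    -- With `d = Dφ a - a` and `e = Dφ b - b`, skewness and `hSP` turn the difference of the sides
    -- into `⟨Sd, b⟩ + ⟨Sa, e⟩ + ⟨Sd, e⟩`, which vanishes by symplecticity.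
    have key : ∀ a b : E, inner ℝ (S (fderiv ℝ φ y a - a)) (b + P (fderiv ℝ φ y b - b)) =
        inner ℝ (S (fderiv ℝ φ y b - b)) (a + P (fderiv ℝ φ y a - a)) := by
      intro a b
      have h1 := hsymp y a b
      have hanti : ∀ x y, inner ℝ (S x) y = -inner ℝ (S y) x := fun x y => by
        rw [hskew, real_inner_comm]
      have h2 := hSP (fderiv ℝ φ y a - a) (fderiv ℝ φ y b - b)
      have h3 := hanti (P (fderiv ℝ φ y a - a)) (fderiv ℝ φ y b - b)
      have h4 := hanti a (fderiv ℝ φ y b)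
      have h5 := hanti a b
      rw [inner_add_right, inner_add_right]
      simp only [map_sub, inner_sub_left, inner_sub_right] at h1 h2 h3 h4 h5 ⊢
      linarith
    have hF'' : ∀ v w, inner ℝ (fderiv ℝ F z v) w =
        -(h⁻¹ * inner ℝ (S (fderiv ℝ φ y (B v) - B v)) (B w + P (fderiv ℝ φ y (B w) - B w))) := by
      intro v w
      rw [← hAB w, hF', ← real_inner_smul_left, ← inner_neg_left]
      rfl
    rw [hF'', hF'', key])
  refine ⟨G, hGs, fun y => ?_⟩
  have hey : e.symm (y + P (Φ y h - y)) = y := by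
    have : e y = y + P (Φ y h - y) := he y
    rw [← this]
    exact e.symm_apply_apply y
  rw [hG]
  simp only [F, hey, map_neg, map_smul, hS, smul_neg, neg_neg, φ]

end Symplectic

/-! ### The concrete phase space and its two projections `P` -/

/-- The matrix `J⁻¹` as a continuous linear map. -/
noncomputable def sympInvCLM (n : ℕ) : PhaseSpace n →L[ℝ] PhaseSpace n :=
  Matrix.toEuclideanCLM (n := Fin n ⊕ Fin n) (𝕜 := ℝ) (sympJ n)⁻¹

theorem hamiltonianField_eq {n : ℕ} (H : PhaseSpace n → ℝ) (y : PhaseSpace n) :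
    hamiltonianField H y = sympInvCLM n (gradient H y) := rfl

theorem sympInvCLM_inl {n : ℕ} (x : PhaseSpace n) (i : Fin n) :
    sympInvCLM n x (Sum.inl i) = -x (Sum.inr i) := by
  change ((sympJ n)⁻¹.mulVec x.ofLp) (Sum.inl i) = _
  rw [sympJ_inv, Matrix.fromBlocks_mulVec]
  simp [Matrix.neg_mulVec]

theorem sympInvCLM_inr {n : ℕ} (x : PhaseSpace n) (i : Fin n) :
    sympInvCLM n x (Sum.inr i) = x (Sum.inl i) := by
  change ((sympJ n)⁻¹.mulVec x.ofLp) (Sum.inr i) = _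
  rw [sympJ_inv, Matrix.fromBlocks_mulVec]
  simp

theorem sympInvCLM_sympInvCLM {n : ℕ} (x : PhaseSpace n) :
    sympInvCLM n (sympInvCLM n x) = -x := by
  ext i
  rcases i with i | i <;> simp [sympInvCLM_inl, sympInvCLM_inr]

theorem inner_sympInvCLM {n : ℕ} (x y : PhaseSpace n) :
    inner ℝ (sympInvCLM n x) y = -inner ℝ x (sympInvCLM n y) := by
  simp only [PiLp.inner_apply, Fintype.sum_sum_type, sympInvCLM_inl, sympInvCLM_inr]
  simp

/-- The projection `(p, q) ↦ (p, 0)` onto the momentum. -/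
noncomputable def momentumProj (n : ℕ) : PhaseSpace n →L[ℝ] PhaseSpace n :=
  Matrix.toEuclideanCLM (n := Fin n ⊕ Fin n) (𝕜 := ℝ) (Matrix.diagonal (Sum.elim 1 0))

theorem momentumProj_inl {n : ℕ} (x : PhaseSpace n) (i : Fin n) :
    momentumProj n x (Sum.inl i) = x (Sum.inl i) := by
  change (Matrix.mulVec _ x.ofLp) (Sum.inl i) = _
  simp [Matrix.mulVec_diagonal]

theorem momentumProj_inr {n : ℕ} (x : PhaseSpace n) (i : Fin n) :
    momentumProj n x (Sum.inr i) = 0 := by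
  change (Matrix.mulVec _ x.ofLp) (Sum.inr i) = _
  simp [Matrix.mulVec_diagonal]

theorem norm_momentumProj_le (n : ℕ) : ‖momentumProj n‖ ≤ 1 := by
  refine ((Matrix.l2_opNorm_toEuclideanCLM _).trans (Matrix.l2_opNorm_diagonal _)).trans_le ?_
  rw [pi_norm_le_iff_of_nonneg zero_le_one]
  rintro (i | i) <;> simp

theorem mixedState_eq {n : ℕ} (y₀ y₁ : PhaseSpace n) :
    mixedState y₀ y₁ = y₀ + momentumProj n (y₁ - y₀) := by
  ext i
  rcases i with i | i <;> simp [mixedState, momentumProj_inl, momentumProj_inr]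

theorem inner_sympInvCLM_momentumProj {n : ℕ} (x y : PhaseSpace n) :
    inner ℝ (sympInvCLM n x) (momentumProj n y) + inner ℝ (sympInvCLM n (momentumProj n x)) y =
      inner ℝ (sympInvCLM n x) y := by
  simp only [PiLp.inner_apply, Fintype.sum_sum_type, sympInvCLM_inl, sympInvCLM_inr,
    momentumProj_inl, momentumProj_inr]
  simp

theorem ContDiff.hamiltonianField {n : ℕ} {H : PhaseSpace n → ℝ} (hH : ContDiff ℝ ∞ H) :
    ContDiff ℝ ∞ (hamiltonianField H) :=
  (sympInvCLM n).contDiff.comp hH.gradient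

/-- Both trajectories lie in one closed ball, on which the smooth field is Lipschitz, so Grönwall
uniqueness applies. -/
theorem IsFlowImage.unique {n : ℕ} {H : PhaseSpace n → ℝ} (hH : ContDiff ℝ ∞ H) {h : ℝ}
    (hh : 0 ≤ h) {y₀ y₁ y₂ : PhaseSpace n} (h₁ : IsFlowImage H h y₀ y₁)
    (h₂ : IsFlowImage H h y₀ y₂) : y₁ = y₂ := by
  obtain ⟨γ, hγ0, hγh, hγ⟩ := h₁
  obtain ⟨δ, hδ0, hδh, hδ⟩ := h₂
  have hγc : ContinuousOn γ (Set.Icc 0 h) := fun t ht => (hγ t ht).continuousWithinAt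
  have hδc : ContinuousOn δ (Set.Icc 0 h) := fun t ht => (hδ t ht).continuousWithinAt
  obtain ⟨R, hR⟩ := ((isCompact_Icc.image_of_continuousOn hγc).union
    (isCompact_Icc.image_of_continuousOn hδc)).isBounded.subset_closedBall 0
  obtain ⟨K, hK⟩ := hH.hamiltonianField.contDiffOn.exists_lipschitzOnWith (by simp)
    (convex_closedBall 0 R) (isCompact_closedBall 0 R)
  have hnhds : ∀ t ∈ Set.Ico 0 h, Set.Icc 0 h ∈ nhdsWithin t (Set.Ici t) := fun t ht =>
    Filter.mem_of_superset (Icc_mem_nhdsGE ht.2) (Set.Icc_subset_Icc_left ht.1)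
  have heq := ODE_solution_unique_of_mem_Icc_right (v := fun _ => hamiltonianField H)
    (s := fun _ => Metric.closedBall 0 R) (a := 0) (b := h) (K := K) (f := γ) (g := δ)
    (fun _ _ => hK) hγc
    (fun t ht => (hγ t (Set.Ico_subset_Icc_self ht)).mono_of_mem_nhdsWithin (hnhds t ht))
    (fun t ht => hR (Or.inl ⟨t, Set.Ico_subset_Icc_self ht, rfl⟩)) hδc
    (fun t ht => (hδ t (Set.Ico_subset_Icc_self ht)).mono_of_mem_nhdsWithin (hnhds t ht))
    (fun t ht => hR (Or.inr ⟨t, Set.Ico_subset_Icc_self ht, rfl⟩)) (hγ0.trans hδ0.symm)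
  rw [← hγh, ← hδh]
  exact heq ⟨hh, le_rfl⟩

theorem exists_modified_of_lipschitz {n : ℕ} {H : PhaseSpace n → ℝ} (hH : ContDiff ℝ ∞ H)
    {L : NNReal} (hL : LipschitzWith L (hamiltonianField H)) :
    ∃ h₀ : ℝ, 0 < h₀ ∧ ∀ h : ℝ, 0 < h → h < h₀ →
      (∀ y₀, ∃! y₁, IsFlowImage H h y₀ y₁) ∧
      (∃ Hse : PhaseSpace n → ℝ, IsModifiedSymplecticEuler H h Set.univ Hse) ∧
      (∃ Hmp : PhaseSpace n → ℝ, IsModifiedMidpoint H h Set.univ Hmp) := by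
  -- This forces `h * L ≤ 1/4`; the `+ 1` covers `L = 0`.
  refine ⟨1 / (4 * (L + 1)), by positivity, fun h hh hh₀ => ?_⟩
  have hhL : h * L ≤ 1 / 4 := by
    rw [lt_div_iff₀ (by positivity)] at hh₀
    nlinarith
  obtain ⟨Φ, hΦ0, hΦ, hmod⟩ := exists_flow_and_modified_hamiltonian sympInvCLM_sympInvCLM
    inner_sympInvCLM hH hL hh.le hhL
  have hflow : ∀ y, IsFlowImage H h y (Φ y h) := fun y => ⟨Φ y, hΦ0 y, rfl, hΦ y⟩
  refine ⟨fun y => ⟨Φ y h, hflow y, fun z hz => hz.unique hH hh.le (hflow y)⟩, ?_, ?_⟩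
  · obtain ⟨G, hG, hGy⟩ := hmod (momentumProj n) (norm_momentumProj_le n)
      inner_sympInvCLM_momentumProj
    refine ⟨G, hG, fun y _ z hz => ?_⟩
    rw [hz.unique hH hh.le (hflow y), mixedState_eq]
    exact hGy y
  · obtain ⟨G, hG, hGy⟩ := hmod ((2 : ℝ)⁻¹ • ContinuousLinearMap.id ℝ (PhaseSpace n))
      (by
        rw [norm_smul]
        have := ContinuousLinearMap.norm_id_le (𝕜 := ℝ) (E := PhaseSpace n)
        norm_num
        linarith)
      (fun x y => by
        simp only [smul_apply, ContinuousLinearMap.id_apply, map_smul,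
          real_inner_smul_left, real_inner_smul_right]
        ring)
    refine ⟨G, hG, fun y _ z hz => ?_⟩
    rw [hz.unique hH hh.le (hflow y)]
    have hmid : (2 : ℝ)⁻¹ • (y + Φ y h) =
        y + ((2 : ℝ)⁻¹ • ContinuousLinearMap.id ℝ (PhaseSpace n)) (Φ y h - y) := by
      simp only [smul_apply, ContinuousLinearMap.id_apply]
      module
    rw [hmid]
    exact hGy y

/-- If two Hamiltonians agree on a ball and the second field is bounded, then for short times
the trajectories of the second one that start well inside the ball are trajectories of the first. -/
theorem IsFlowImage.congr_of_eqOn_ball {n : ℕ} {H H' : PhaseSpace n → ℝ} {R C h : ℝ}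
    (hHH' : Set.EqOn H' H (Metric.ball 0 (R + 2))) (hC : ∀ y, ‖hamiltonianField H' y‖ ≤ C)
    (hCh : C * h ≤ 1) {y₀ y₁ : PhaseSpace n} (hy₀ : ‖y₀‖ ≤ R)
    (hfl : IsFlowImage H' h y₀ y₁) : IsFlowImage H h y₀ y₁ := by
  obtain ⟨γ, hγ0, hγh, hγ⟩ := hfl
  refine ⟨γ, hγ0, hγh, fun t ht => ?_⟩
  have hC0 : 0 ≤ C := (norm_nonneg _).trans (hC 0)
  have h1 : ‖γ t - γ 0‖ ≤ C * (t - 0) :=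
    norm_image_sub_le_of_norm_deriv_le_segment' hγ (fun s _ => hC (γ s)) t ht
  have h2 : C * (t - 0) ≤ 1 :=
    (mul_le_mul_of_nonneg_left (by linarith [ht.2]) hC0).trans hCh
  have h3 : γ t ∈ Metric.ball 0 (R + 2) := by
    rw [mem_ball_zero_iff]
    have := norm_add_le (γ t - γ 0) (γ 0)
    rw [sub_add_cancel, hγ0] at this
    rw [hγ0] at h1
    linarith
  have h4 : gradient H' (γ t) = gradient H (γ t) := by
    rw [gradient, gradient, (hHH'.eventuallyEq_of_mem (Metric.isOpen_ball.mem_nhds h3)).fderiv_eq]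
  have h5 := hγ t ht
  rwa [hamiltonianField_eq, h4, ← hamiltonianField_eq] at h5

/-- A smooth function can be cut off outside a ball. -/
theorem exists_cutoff {E : Type*} [NormedAddCommGroup E] [InnerProductSpace ℝ E]
    [FiniteDimensional ℝ E] {H : E → ℝ} (hH : ContDiff ℝ ∞ H) (R : ℝ) (hR : 0 < R) :
    ∃ H' : E → ℝ, ContDiff ℝ ∞ H' ∧ HasCompactSupport H' ∧ Set.EqOn H' H (Metric.ball 0 R) := by
  let χ : ContDiffBump (0 : E) := ⟨R, R + 1, hR, by linarith⟩
  refine ⟨fun x => χ x * H x, χ.contDiff.mul hH, χ.hasCompactSupport.mul_right, fun x hx => ?_⟩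
  simp [χ.one_of_mem_closedBall (Metric.ball_subset_closedBall hx)]

theorem exists_modified_of_isCompact {n : ℕ} {H : PhaseSpace n → ℝ} (hH : ContDiff ℝ ∞ H)
    {K : Set (PhaseSpace n)} (hK : IsCompact K) :
    ∃ h₀ : ℝ, 0 < h₀ ∧ ∀ h : ℝ, 0 < h → h < h₀ →
      (∀ y₀ ∈ K, ∃! y₁, IsFlowImage H h y₀ y₁) ∧
      (∃ Hse : PhaseSpace n → ℝ, IsModifiedSymplecticEuler H h K Hse) ∧
      (∃ Hmp : PhaseSpace n → ℝ, IsModifiedMidpoint H h K Hmp) := by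
  obtain ⟨R, hR, hKR⟩ : ∃ R : ℝ, 0 < R ∧ ∀ y ∈ K, ‖y‖ ≤ R := hK.isBounded.exists_pos_norm_le
  -- Trajectories from `K` will move by at most `1`, so they stay in this open ball.
  obtain ⟨H', hH', hsupp, hHH'⟩ := exists_cutoff hH (R + 2) (by linarith)
  have hXsupp : HasCompactSupport (hamiltonianField H') :=
    (hsupp.fderiv ℝ).comp_left (g := fun l => sympInvCLM n (rieszRepr _ l)) (by simp)
  obtain ⟨L, hL⟩ := hH'.hamiltonianField.lipschitzWith_of_hasCompactSupport hXsupp (by simp)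
  obtain ⟨C, hC⟩ := hXsupp.exists_bound_of_continuous hH'.hamiltonianField.continuous
  have hC0 : 0 ≤ C := (norm_nonneg _).trans (hC 0)
  obtain ⟨h₀, hh₀, hmod⟩ := exists_modified_of_lipschitz hH' hL
  refine ⟨min h₀ (1 / (C + 1)), by positivity, fun h hh hlt => ?_⟩
  obtain ⟨hex, ⟨Gse, hGse, hse⟩, Gmp, hGmp, hmp⟩ := hmod h hh (hlt.trans_le (min_le_left _ _))
  have hCh : C * h ≤ 1 := by
    have := hlt.trans_le (min_le_right _ _)
    rw [lt_div_iff₀ (by positivity)] at this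
    linarith
  have hto : ∀ y₀ ∈ K, ∀ y₁, IsFlowImage H' h y₀ y₁ → IsFlowImage H h y₀ y₁ :=
    fun y₀ hy₀ _ => IsFlowImage.congr_of_eqOn_ball hHH' hC hCh (hKR y₀ hy₀)
  -- No bound on `H`-trajectories is needed: the `H'`-image is an `H`-image, and uniqueness
  -- identifies the two.
  have hfrom : ∀ y₀ ∈ K, ∀ y₁, IsFlowImage H h y₀ y₁ → IsFlowImage H' h y₀ y₁ := by
    intro y₀ hy₀ y₁ h₁
    obtain ⟨z, hz, -⟩ := hex y₀
    rwa [h₁.unique hH hh.le (hto y₀ hy₀ z hz)]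
  refine ⟨fun y₀ hy₀ => ?_, ⟨Gse, hGse, fun y₀ hy₀ y₁ h₁ => ?_⟩,
    ⟨Gmp, hGmp, fun y₀ hy₀ y₁ h₁ => ?_⟩⟩
  · obtain ⟨z, hz, -⟩ := hex y₀
    exact ⟨z, hto y₀ hy₀ z hz, fun w hw => hw.unique hH hh.le (hto y₀ hy₀ z hz)⟩
  · exact hse y₀ trivial y₁ (hfrom y₀ hy₀ y₁ h₁)
  · exact hmp y₀ trivial y₁ (hfrom y₀ hy₀ y₁ h₁)

theorem proposition1 (n : ℕ) (H : PhaseSpace n → ℝ) (hH : ContDiff ℝ ∞ H) :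
    (∀ K : Set (PhaseSpace n), IsCompact K →
      ∃ h₀ : ℝ, 0 < h₀ ∧ ∀ h : ℝ, 0 < h → h < h₀ →
        (∀ y₀ ∈ K, ∃! y₁, IsFlowImage H h y₀ y₁) ∧
        (∃ Hse : PhaseSpace n → ℝ, IsModifiedSymplecticEuler H h K Hse) ∧
        (∃ Hmp : PhaseSpace n → ℝ, IsModifiedMidpoint H h K Hmp)) ∧
    ((∃ L : NNReal, LipschitzWith L (gradient H)) →
      ∃ h₀ : ℝ, 0 < h₀ ∧ ∀ h : ℝ, 0 < h → h < h₀ →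
        (∀ y₀, ∃! y₁, IsFlowImage H h y₀ y₁) ∧
        (∃ Hse : PhaseSpace n → ℝ, IsModifiedSymplecticEuler H h Set.univ Hse) ∧
        (∃ Hmp : PhaseSpace n → ℝ, IsModifiedMidpoint H h Set.univ Hmp)) :=
  ⟨fun _ hK => exists_modified_of_isCompact hH hK,
    fun ⟨_, hL⟩ => exists_modified_of_lipschitz hH ((sympInvCLM n).lipschitz.comp hL)⟩
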